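/- All groups are finite. A number is called a prime power if it is of the form $r^k$ with $r$ prime and $k\ge 0$ (so $1$ is allowed), and composite if it is divisible by at least two distinct primes. Let $G$ be a finite group. * $G$ is an *Oliver group* if there are no subgroups $P\trianglelefteq H\trianglelefteq G$ such that $|P|$ and $|G/H|$ are prime powers (possibly of different primes) and $H/P$ is cyclic. * For a prime $r$, $\mathcal O^r(G)$ is the smallest normal subgroup of $G$ whose quotient is an $r$-group. A subgroup $L\le G$ is *large* if $\mathcal O^r(G)\le L$ for some prime $r$. * $G$ is a *gap group* if there is a finite-dimensional real $G$-module $V$ such that $\dim V^P>2\dim V^H$ for all subgroups $P<H\le G$ with $|P|$ a prime power, and $\dim V^L=0$ for every large subgroup $L$ of $G$. * $G^{\mathrm{nil}}$ is the smallest normal subgroup of $G$ with nilpotent quotient. * $G$ satisfies the *Sumi $G^{\mathrm{nil}}$-condition* if there are $x,y\in G$ of composite order such that $x$ is conjugate in $G$ neither to $y$ nor to $y^{-1}$, such that $xG^{\mathrm{nil}}=yG^{\mathrm{nil}}$, and such that at least one of the following holds: (i) $|x|$ and $|y|$ are even and the involutions of $\langle x\rangle$ and $\langle y\rangle$ are conjugate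 in $G$; (ii) some subgroup of $G$ that is a gap group contains both $x$ and $y$. * $G$ is a *special Oliver group* if it is a solvable Oliver group of even order, no cyclic quotient of $G$ has odd composite order, and $G$ does not satisfy the Sumi $G^{\mathrm{nil}}$-condition. Let $p,q$ be odd primes with $q\mid p-1$, let $v$ be an integer that is a primitive root modulo $p$ and is not divisible by $q$, and let $i=v^{(p-1)(q-1)/q}$ modulo $pq$; then $i^q\equiv 1\pmod{pq}$. Let $D_{2pq}=\langle a,b\mid a^{pq}=b^2=1,\ bab=a^{-1}\rangle$ be the dihedral group of order $2pq$ and $C_q=\langle c\mid c^q=1\rangle$ the cyclic group of order $q$, and let $$G_{p,q}=D_{2pq}\rtimes_\varphi C_q,$$ where $\varphi(c)$ is the automorphism of $D_{2pq}$ with $a\mapsto a^i$ and $b\mapsto b$. **Lemma.** $G_{p,q}$ is a special Oliver group. -/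

import Mathlib

namespace SpecialOliver

/-! ### Prime power orders and residual subgroups -/

/-- `n` is a power `r ^ k` of a prime `r`; the exponent `k = 0`, i.e. `n = 1`, is allowed. -/
def IsPrimePower (n : ℕ) : Prop :=
  ∃ r k : ℕ, r.Prime ∧ n = r ^ k

/-- `n` is composite, in the sense that it is divisible by at least two distinct primes. -/
def IsComposite (n : ℕ) : Prop :=
  ∃ r s : ℕ, r.Prime ∧ s.Prime ∧ r ≠ s ∧ r ∣ n ∧ s ∣ n

/-- `O^r(G)`, the smallest normal subgroup of `G` whose quotient is an `r`-group. -/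
def pResidual (r : ℕ) (G : Type*) [Group G] : Subgroup G :=
  sInf {N : Subgroup G | ∃ _ : N.Normal, IsPGroup r (G ⧸ N)}

/-- `G^nil`, the smallest normal subgroup of `G` whose quotient is nilpotent. -/
def nilResidual (G : Type*) [Group G] : Subgroup G :=
  sInf {N : Subgroup G | ∃ _ : N.Normal, Group.IsNilpotent (G ⧸ N)}

/-- On a finite group, `O^r(G)` is indeed the least member of the family that defines it. -/
theorem pResidual_isLeast (r : ℕ) (G : Type*) [Group G] [Finite G] :
    IsLeast {N : Subgroup G | ∃ _ : N.Normal, IsPGroup r (G ⧸ N)} (pResidual r G) := by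
  refine ⟨?_, fun N hN => sInf_le hN⟩
  have hnorm : (pResidual r G).Normal := by
    rw [pResidual, sInf_eq_iInf']
    exact Subgroup.normal_iInf_normal fun N => N.2.1
  refine ⟨hnorm, ?_⟩
  rw [isPGroup_iff_pow_pow_eq_one]
  intro x
  obtain ⟨g, rfl⟩ := QuotientGroup.mk_surjective x
  have h : ∀ N : {N : Subgroup G // ∃ _ : N.Normal, IsPGroup r (G ⧸ N)},
      ∃ k, g ^ r ^ k ∈ N.1 := by
    rintro ⟨N, hN, hr⟩
    obtain ⟨k, hk⟩ := isPGroup_iff_pow_pow_eq_one.1 hr (g : G ⧸ N)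
    exact ⟨k, (QuotientGroup.eq_one_iff _).1 (by simpa using hk)⟩
  choose k hk using h
  obtain ⟨K, hK⟩ := (Set.finite_range k).bddAbove
  refine ⟨K, ?_⟩
  rw [← QuotientGroup.mk_pow, QuotientGroup.eq_one_iff]
  refine Subgroup.mem_sInf.2 fun N hN => ?_
  obtain ⟨d, hd⟩ := Nat.exists_eq_add_of_le (hK ⟨⟨N, hN⟩, rfl⟩)
  rw [hd, pow_add, pow_mul]
  exact N.pow_mem (hk ⟨N, hN⟩) _

/-- On a finite group, `G^nil` is indeed the least member of the family that defines it. -/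
theorem nilResidual_isLeast (G : Type*) [Group G] [Finite G] :
    IsLeast {N : Subgroup G | ∃ _ : N.Normal, Group.IsNilpotent (G ⧸ N)} (nilResidual G) := by
  refine ⟨?_, fun N hN => sInf_le hN⟩
  have hnorm : (nilResidual G).Normal := by
    rw [nilResidual, sInf_eq_iInf']
    exact Subgroup.normal_iInf_normal fun N => N.2.1
  refine ⟨hnorm, ?_⟩
  let S := {N : Subgroup G // ∃ _ : N.Normal, Group.IsNilpotent (G ⧸ N)}
  have : ∀ N : S, N.1.Normal := fun N => N.2.1
  have : ∀ N : S, Group.IsNilpotent (G ⧸ N.1) := fun N => N.2.2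
  let f : G →* ∀ N : S, G ⧸ N.1 := MonoidHom.pi fun N => QuotientGroup.mk' N.1
  have hker : f.ker = nilResidual G := by
    ext x
    rw [MonoidHom.mem_ker, funext_iff, nilResidual, Subgroup.mem_sInf]
    exact ⟨fun h N hN => have := hN.1; (QuotientGroup.eq_one_iff x).1 (h ⟨N, hN⟩),
      fun h N => (QuotientGroup.eq_one_iff x).2 (h N.1 N.2)⟩
  have : Group.IsNilpotent (G ⧸ f.ker) :=
    Subgroup.isNilpotent_of_ker_le_center (QuotientGroup.kerLift f)
      (by rw [(MonoidHom.ker_eq_bot_iff _).2 (QuotientGroup.kerLift_injective f)]; exact bot_le)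
  exact Group.nilpotent_of_mulEquiv (QuotientGroup.quotientMulEquivOfEq hker)

/-! ### Oliver groups -/

/-- `G` is an Oliver group: there are no `P ⊴ H ⊴ G` with `P` and `G/H` of prime power order and
`H/P` cyclic. -/
def IsOliverGroup (G : Type*) [Group G] : Prop :=
  ¬ ∃ (H : Subgroup G) (P : Subgroup H) (_ : H.Normal) (_ : P.Normal),
    IsPrimePower (Nat.card P) ∧ IsPrimePower (Nat.card (G ⧸ H)) ∧ IsCyclic (H ⧸ P)

/-! ### Gap groups -/

/-- A subgroup is large if it contains `O^r(G)` for some prime `r`. -/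
def IsLarge {G : Type*} [Group G] (L : Subgroup G) : Prop :=
  ∃ r : ℕ, r.Prime ∧ pResidual r G ≤ L

/-- `dim V^H`, the real dimension of the space of `H`-fixed vectors of a real `G`-module `V`. -/
noncomputable def fixedDim {G : Type*} [Group G] {V : Type*} [AddCommGroup V] [Module ℝ V]
    (ρ : Representation ℝ G V) (H : Subgroup G) : ℕ :=
  Module.finrank ℝ (Representation.invariants (MonoidHom.comp ρ H.subtype))

/-- `G` is a gap group: there is a (finite-dimensional) real `G`-module `V` such that
`dim V^P > 2 dim V^H` for all subgroups `P < H` with `P` of prime power order, and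
`dim V^L = 0` for all large subgroups `L`. -/
def IsGapGroup (G : Type*) [Group G] : Prop :=
  ∃ (V : Type) (_ : AddCommGroup V) (_ : Module ℝ V) (_ : FiniteDimensional ℝ V)
    (ρ : Representation ℝ G V),
    (∀ P H : Subgroup G, P < H → IsPrimePower (Nat.card P) →
      2 * fixedDim ρ H < fixedDim ρ P) ∧
    ∀ L : Subgroup G, IsLarge L → fixedDim ρ L = 0

/-! ### The Sumi condition -/

/-- `x` lies in the real conjugacy class of `y`, the union of the classes of `y` and `y⁻¹`. -/
def IsRealConj {G : Type*} [Group G] (x y : G) : Prop :=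
  IsConj x y ∨ IsConj x y⁻¹

/-- `x` and `y` have even order, and the involutions of the cyclic subgroups generated by `x` and
by `y` are conjugate in `G`. -/
def HaveConjInvolutions {G : Type*} [Group G] (x y : G) : Prop :=
  Even (orderOf x) ∧ Even (orderOf y) ∧
    ∃ s ∈ Subgroup.zpowers x, ∃ t ∈ Subgroup.zpowers y,
      orderOf s = 2 ∧ orderOf t = 2 ∧ IsConj s t

/-- The Sumi `G^nil`-condition. -/
def SumiNilCondition (G : Type*) [Group G] : Prop :=
  ∃ x y : G, IsComposite (orderOf x) ∧ IsComposite (orderOf y) ∧ ¬ IsRealConj x y ∧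
    (x : G ⧸ nilResidual G) = (y : G ⧸ nilResidual G) ∧
    (HaveConjInvolutions x y ∨ ∃ K : Subgroup G, IsGapGroup K ∧ x ∈ K ∧ y ∈ K)

/-! ### Special Oliver groups -/

/-- A special Oliver group: a finite solvable Oliver group of even order, without cyclic quotients
of odd composite order, that does not satisfy the Sumi `G^nil`-condition. -/
structure IsSpecialOliver (G : Type*) [Group G] : Prop where
  finite : Finite G
  solvable : Group.IsSolvable G
  oliver : IsOliverGroup G
  even_card : Even (Nat.card G)
  cyclic_quotient : ∀ (N : Subgroup G) [N.Normal], IsCyclic (G ⧸ N) →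
    ¬ (Odd (Nat.card (G ⧸ N)) ∧ IsComposite (Nat.card (G ⧸ N)))
  not_sumi : ¬ SumiNilCondition G

/-! ### The groups `G_{p,q}`

`DihedralGroup n` has order `2 * n`, with `a = r 1`, `b = sr 0`, `a ^ k = r k` and
`b * a ^ k = sr k`. The cyclic group `C_q` is `Multiplicative (ZMod q)`, with the generator
`c = Multiplicative.ofAdd 1`. -/

/-- The automorphism of the dihedral group of order `2 * n` that is given by `a ↦ a ^ i` and
`b ↦ b`, for a unit `i` modulo `n`. -/
def dihedralAut {n : ℕ} (i : (ZMod n)ˣ) : MulAut (DihedralGroup n) where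
  toFun
    | .r k => .r (i * k)
    | .sr k => .sr (i * k)
  invFun
    | .r k => .r ((i⁻¹ : (ZMod n)ˣ) * k)
    | .sr k => .sr ((i⁻¹ : (ZMod n)ˣ) * k)
  left_inv x := by cases x <;> simp
  right_inv x := by cases x <;> simp
  map_mul' x y := by cases x <;> cases y <;> simp [mul_add, mul_sub]

theorem dihedralAut_pow {n : ℕ} (i : (ZMod n)ˣ) (k : ℕ) :
    dihedralAut i ^ k = dihedralAut (i ^ k) := by
  induction k with
  | zero => ext x; cases x <;> simp [dihedralAut]
  | succ k ih => rw [pow_succ, ih]; ext x; cases x <;> simp [dihedralAut, pow_succ, mul_assoc]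

/-- The homomorphism `C_n → A` that sends the generator `c` to `g`, where `g ^ n = 1`. -/
def cyclicHom {A : Type*} [Group A] (n : ℕ) (g : A) (hg : g ^ n = 1) :
    Multiplicative (ZMod n) →* A :=
  AddMonoidHom.toMultiplicativeLeft
    (ZMod.lift n ⟨zmultiplesHom (Additive A) (Additive.ofMul g), by
      simp [← ofMul_pow, hg]⟩)

theorem cyclicHom_generator {A : Type*} [Group A] (n : ℕ) (g : A) (hg : g ^ n = 1) :
    cyclicHom n g hg (Multiplicative.ofAdd 1) = g := by
  have h := ZMod.lift_coe n (A := Additive A) ⟨zmultiplesHom (Additive A) (Additive.ofMul g), by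
      simp [← ofMul_pow, hg]⟩ 1
  simp only [Int.cast_one] at h
  simp [cyclicHom, h]

section

variable {p q : ℕ} {v : ℤ}

/-- With `i = v ^ ((p - 1) * (q - 1) / q)`, one has `i ^ q = 1` modulo `p * q`. -/
theorem twist_pow_eq_one (hp : p.Prime) (hq : q.Prime) (hqp : q ∣ p - 1)
    (hv : IsPrimitiveRoot (v : ZMod p) (p - 1)) (hqv : ¬ (q : ℤ) ∣ v) :
    ((v : ZMod (p * q)) ^ ((p - 1) * (q - 1) / q)) ^ q = 1 := by
  have : Fact q.Prime := ⟨hq⟩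
  rw [← pow_mul, Nat.div_mul_cancel (hqp.mul_right _)]
  have hne : p ≠ q := by
    rintro rfl
    have := Nat.le_of_dvd (by have := hp.two_le; omega) hqp
    have := hp.two_le
    omega
  have h1 : (p : ℤ) ∣ v ^ ((p - 1) * (q - 1)) - 1 := by
    rw [← ZMod.intCast_zmod_eq_zero_iff_dvd]
    push_cast
    rw [pow_mul, hv.pow_eq_one, one_pow, sub_self]
  have h2 : (q : ℤ) ∣ v ^ ((p - 1) * (q - 1)) - 1 := by
    rw [← ZMod.intCast_zmod_eq_zero_iff_dvd]
    push_cast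
    have h0 : (v : ZMod q) ≠ 0 := fun h => hqv ((ZMod.intCast_zmod_eq_zero_iff_dvd _ _).1 h)
    rw [mul_comm, pow_mul, ZMod.pow_card_sub_one_eq_one h0, one_pow, sub_self]
  have h3 : ((p * q : ℕ) : ℤ) ∣ v ^ ((p - 1) * (q - 1)) - 1 := by
    push_cast
    exact IsCoprime.mul_dvd (Nat.isCoprime_iff_coprime.2 ((Nat.coprime_primes hp hq).2 hne)) h1 h2
  have h4 := (ZMod.intCast_zmod_eq_zero_iff_dvd _ _).2 h3
  push_cast at h4
  exact sub_eq_zero.1 h4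

/-- The unit `i = v ^ ((p - 1) * (q - 1) / q)` modulo `p * q`. -/
def twist (hp : p.Prime) (hq : q.Prime) (hqp : q ∣ p - 1)
    (hv : IsPrimitiveRoot (v : ZMod p) (p - 1)) (hqv : ¬ (q : ℤ) ∣ v) : (ZMod (p * q))ˣ :=
  Units.ofPowEqOne ((v : ZMod (p * q)) ^ ((p - 1) * (q - 1) / q)) q
    (twist_pow_eq_one hp hq hqp hv hqv) hq.ne_zero

/-- The automorphism `τ` of `D_{2pq}` with `τ(a) = a ^ i` and `τ(b) = b` satisfies `τ ^ q = 1`. -/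
theorem dihedralAut_twist_pow (hp : p.Prime) (hq : q.Prime) (hqp : q ∣ p - 1)
    (hv : IsPrimitiveRoot (v : ZMod p) (p - 1)) (hqv : ¬ (q : ℤ) ∣ v) :
    dihedralAut (twist hp hq hqp hv hqv) ^ q = 1 := by
  rw [dihedralAut_pow, twist, Units.pow_ofPowEqOne]
  ext x
  cases x <;> simp [dihedralAut]

/-- The group `G_{p,q} = D_{2pq} ⋊ C_q`, where the generator `c` of `C_q` acts by `τ`. -/
abbrev Gpq (hp : p.Prime) (hq : q.Prime) (hqp : q ∣ p - 1)
    (hv : IsPrimitiveRoot (v : ZMod p) (p - 1)) (hqv : ¬ (q : ℤ) ∣ v) : Type :=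
  SemidirectProduct (DihedralGroup (p * q)) (Multiplicative (ZMod q))
    (cyclicHom q (dihedralAut (twist hp hq hqp hv hqv)) (dihedralAut_twist_pow hp hq hqp hv hqv))

end

end SpecialOliver

/-! Write elements as rotations `a ^ k * j` and reflections `b * a ^ k * j`, with `j` in the acting
group, and let `u = U j` be the unit by which `j` acts. Two facts carry the proof: `u` is trivial
modulo `q` but not modulo `p` for `j ≠ 1`, and `1 + u` is always invertible, since it divides `1 + u
^ q = 2`.

Sumi condition: `G^nil` lies in `⟨a⟩`, so `x` and `y` agree in sign and in `j`. Reflections that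
agree in `j` are conjugate under `⟨a⟩`, because `1 + u` is a unit; so `x` and `y` are rotations.
These have no involutions among their powers. A rotation with `j ≠ 1` has order `q`, so composite
order forces `x` to generate `⟨a⟩`, and a gap subgroup `K` containing `x` would contain `⟨a⟩`.

No such `K` is a gap group. If `K` consists of rotations, its subgroup of order `p` is large.
Otherwise `b ∈ K`. Let `M` be the rotations in `K` and `P` the part of `K` in the acting group. The
coset `M * b` is made of the `⟨a⟩`-conjugates of `P * b`, each hit once; as `V ^ M = V ^ K = 0`, the
character sums to zero over `P * b`, so `P` together with `P * b` fixes exactly half the dimension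
fixed by `P`, against the strict gap inequality (`fixedDim_eq_two_mul`).

Oliver property: commutators of `H` lie in the `r`-group `P`. If `|G/H|` is odd, `a ^ 2`, of order
`p * q`, is such a commutator. If it is a power of two, a commutator of `a` and `c` forces `r = p`,
and the cyclic group `H/P` would have to contain two independent elements of order `q`, the images
of `a ^ p` and `c`. -/

namespace SpecialOliver

/-! ### Characters and fixed point dimensions -/

section Characters

variable {G : Type*} [Group G] [Finite G]

/-- If `P` has index two in `H` and `b` represents the other coset, then a sum over `H` splits into
the sums over the two cosets of `P`. -/
theorem finsum_eq_add_of_two_cosets {M : Type*} [AddCommMonoid M] {P H : Subgroup G} (hPH : P ≤ H)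
    {b : G} (hb : b ∈ H) (hbP : b ∉ P) (hH : ∀ h ∈ H, h ∉ P → h * b⁻¹ ∈ P) (F : G → M) :
    ∑ᶠ h : H, F h = ∑ᶠ h : P, F h + ∑ᶠ h : P, F (h * b) := by
  have := Fintype.ofFinite G
  classical
  simp only [finsum_eq_sum_of_fintype]
  let f : P ⊕ P → H := Sum.elim (fun h => ⟨h, hPH h.2⟩) fun h => ⟨h * b, H.mul_mem (hPH h.2) hb⟩
  have key : ∀ h h' : P, (h : G) ≠ h' * b := fun h h' e => hbP <| by
    have : b = (h' : G)⁻¹ * h := by rw [e]; group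
    rw [this]
    exact P.mul_mem (P.inv_mem h'.2) h.2
  have hf : Function.Bijective f := by
    constructor
    · rintro (x | x) (y | y) h
      · exact congrArg Sum.inl (Subtype.ext (congrArg (fun z : H => (z : G)) h))
      · exact absurd (congrArg Subtype.val h) (key x y)
      · exact absurd (congrArg Subtype.val h).symm (key y x)
      · exact congrArg Sum.inr (Subtype.ext (mul_right_cancel (congrArg (fun z : H => (z : G)) h)))
    · rintro ⟨h, hh⟩
      by_cases hP : h ∈ P
      · exact ⟨Sum.inl ⟨h, hP⟩, rfl⟩
      · exact ⟨Sum.inr ⟨_, hH h hh hP⟩, by simp [f]⟩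
  rw [← hf.sum_comp, Fintype.sum_sum_type]
  rfl

theorem card_eq_two_mul_of_two_cosets {P H : Subgroup G} (hPH : P ≤ H)
    {b : G} (hb : b ∈ H) (hbP : b ∉ P) (hH : ∀ h ∈ H, h ∉ P → h * b⁻¹ ∈ P) :
    Nat.card H = 2 * Nat.card P := by
  have := finsum_eq_add_of_two_cosets hPH hb hbP hH fun _ => 1
  have h1 := Fintype.ofFinite G
  classical
  simp only [finsum_eq_sum_of_fintype] at this
  simp at this
  simp [this, two_mul]

variable {V : Type*} [AddCommGroup V] [Module ℝ V] (ρ : Representation ℝ G V)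

/-- Averaging over `H` projects onto the fixed space, and the trace of this projection is the mean
of the character. -/
theorem card_mul_fixedDim [FiniteDimensional ℝ V] (H : Subgroup G) :
    (Nat.card H : ℝ) * fixedDim ρ H = ∑ᶠ h : H, ρ.character h := by
  have := Fintype.ofFinite G
  classical
  have hne : (Nat.card H : ℝ) ≠ 0 := Nat.cast_ne_zero.2 Nat.card_pos.ne'
  have := invertibleOfNonzero hne
  have h := Representation.card_inv_mul_sum_char_eq_finrank (MonoidHom.comp ρ H.subtype)
  rw [fixedDim, ← h, mul_inv_cancel_left₀ hne, finsum_eq_sum_of_fintype]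
  rfl

/-- If conjugation by `A` spreads the coset `P * b` evenly over the coset `M * b`, then the two
cosets have the same average character value. -/
theorem card_mul_sum_character_coset {A P M : Subgroup G} {b : G} (e : A × P ≃ M)
    (he : ∀ x : A × P, (e x : G) * b = x.1 * (x.2 * b) * (x.1 : G)⁻¹) :
    (Nat.card A : ℝ) * ∑ᶠ h : P, ρ.character (h * b) = ∑ᶠ m : M, ρ.character (m * b) := by
  have := Fintype.ofFinite G
  classical
  simp only [finsum_eq_sum_of_fintype]
  rw [← e.sum_comp, Fintype.sum_prod_type]
  simp [he, Representation.char_conj]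

/-- Let `M` be a subgroup of index two whose complement `M * b` consists of the conjugates by `A` of
`P * b`, each hit once. If neither `M` nor `G` fixes a nonzero vector, then the dimension of the
fixed space of `P` is twice that of `H = P ∪ P * b`. -/
theorem fixedDim_eq_two_mul [FiniteDimensional ℝ V] {A P H M : Subgroup G} {b : G} (e : A × P ≃ M)
    (he : ∀ x : A × P, (e x : G) * b = x.1 * (x.2 * b) * (x.1 : G)⁻¹)
    (hPH : P ≤ H) (hb : b ∈ H) (hbP : b ∉ P) (hH : ∀ h ∈ H, h ∉ P → h * b⁻¹ ∈ P)
    (hbM : b ∉ M) (hM : ∀ h, h ∉ M → h * b⁻¹ ∈ M)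
    (hM0 : fixedDim ρ M = 0) (hG0 : fixedDim ρ ⊤ = 0) :
    fixedDim ρ P = 2 * fixedDim ρ H := by
  have h1 := card_mul_fixedDim ρ H
  rw [finsum_eq_add_of_two_cosets hPH hb hbP hH, ← card_mul_fixedDim,
    card_eq_two_mul_of_two_cosets hPH hb hbP hH] at h1
  -- The sums over the whole group and over `M` both vanish, hence so does the sum over `M * b`,
  -- which is `|A|` times the sum over `P * b`.
  have h2 := card_mul_fixedDim ρ ⊤
  rw [finsum_eq_add_of_two_cosets (P := M) le_top (Subgroup.mem_top b) hbM fun h _ => hM h,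
    ← card_mul_fixedDim, hM0, hG0, ← card_mul_sum_character_coset ρ e he] at h2
  have hA : (Nat.card A : ℝ) ≠ 0 := Nat.cast_ne_zero.2 Nat.card_pos.ne'
  have hP : (Nat.card P : ℝ) ≠ 0 := Nat.cast_ne_zero.2 Nat.card_pos.ne'
  have h3 : ∑ᶠ h : P, ρ.character (h * b) = 0 := by simpa [hA] using h2.symm
  rw [h3, add_zero] at h1
  push_cast at h1
  have h4 : (fixedDim ρ P : ℝ) = 2 * fixedDim ρ H := by
    apply mul_left_cancel₀ hP
    linarith
  exact_mod_cast h4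

end Characters

/-! ### Large subgroups -/

/-- If some proper large subgroup has prime power order, the group is not a gap group. -/
theorem not_isGapGroup_of_isLarge {G : Type*} [Group G] {L : Subgroup G} (hL : IsLarge L) (hlt : L < ⊤)
    (hcard : IsPrimePower (Nat.card L)) : ¬ IsGapGroup G := by
  rintro ⟨V, _, _, _, ρ, h1, h2⟩
  have := h1 L ⊤ hlt hcard
  rw [h2 L hL] at this
  omega

theorem isLarge_top {G : Type*} [Group G] : IsLarge (⊤ : Subgroup G) := ⟨2, Nat.prime_two, le_top⟩

/-- The quotient has exponent dividing `r`, so `N` takes part in the intersection that defines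
`O^r(G)`. -/
theorem isLarge_of_pow_mem {G : Type*} [Group G] {r : ℕ} (hr : r.Prime) {N : Subgroup G}
    [hN : N.Normal] (h : ∀ g : G, g ^ r ∈ N) : IsLarge N := by
  refine ⟨r, hr, sInf_le ⟨hN, isPGroup_iff_pow_pow_eq_one.2 fun x => ?_⟩⟩
  obtain ⟨g, rfl⟩ := QuotientGroup.mk_surjective x
  exact ⟨1, by rw [pow_one, ← QuotientGroup.mk_pow]; exact (QuotientGroup.eq_one_iff _).2 (h g)⟩

/-! ### Quotients and powers -/

/-- The order of the image of `g` divides both `m` and the index of `N`. -/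
theorem mem_of_pow_eq_one_of_coprime {G : Type*} [Group G] [Finite G] {N : Subgroup G} [N.Normal]
    {g : G} {m : ℕ} (hg : g ^ m = 1) (hm : m.Coprime (Nat.card (G ⧸ N))) : g ∈ N := by
  rw [← QuotientGroup.eq_one_iff, ← orderOf_eq_one_iff]
  refine Nat.eq_one_of_dvd_coprimes hm ?_ (orderOf_dvd_natCard _)
  rw [orderOf_dvd_iff_pow_eq_one, ← QuotientGroup.mk_pow, hg, QuotientGroup.mk_one]

theorem commutator_mem_of_isCyclic {G : Type*} [Group G] {N : Subgroup G} [N.Normal]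
    [IsCyclic (G ⧸ N)] (x y : G) : x * y * x⁻¹ * y⁻¹ ∈ N := by
  have := IsCyclic.isMulCommutative (α := G ⧸ N)
  rw [← QuotientGroup.eq_one_iff]
  simp only [QuotientGroup.mk_mul, QuotientGroup.mk_inv]
  rw [mul_comm' (x : G ⧸ N) y]
  group

/-- In a cyclic group `x ^ q = 1` has at most `q` solutions, and the powers of `c` already supply
`q` of them. -/
theorem mem_zpowers_of_pow_prime_eq_one {G : Type*} [Group G] [Finite G] [IsCyclic G] {q : ℕ}
    (hq : q.Prime) {x c : G} (hx : x ^ q = 1) (hc : c ^ q = 1) (hc1 : c ≠ 1) :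
    x ∈ Subgroup.zpowers c := by
  have := Fintype.ofFinite G
  classical
  have := Fact.mk hq
  have hsub : (Subgroup.zpowers c : Set G).toFinset ⊆ Finset.univ.filter fun g : G => g ^ q = 1 := by
    intro g hg
    obtain ⟨n, rfl⟩ := Subgroup.mem_zpowers_iff.1 (Set.mem_toFinset.1 hg)
    refine Finset.mem_filter.2 ⟨Finset.mem_univ _, ?_⟩
    rw [← zpow_natCast, ← zpow_mul, mul_comm, zpow_mul, zpow_natCast, hc, one_zpow]
  have heq := Finset.eq_of_subset_of_card_le hsub <| by
    refine (IsCyclic.card_pow_eq_one_le hq.pos).trans ?_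
    rw [Set.toFinset_card, ← Nat.card_eq_fintype_card]
    exact (orderOf_eq_prime hc hc1).symm.trans (Nat.card_zpowers c).symm |>.le
  have : x ∈ (Subgroup.zpowers c : Set G).toFinset := by rw [heq]; simp [hx]
  simpa using this

/-! ### Dihedral groups twisted by units -/

/-- The action of the units modulo `n` on the dihedral group of order `2 * n`. -/
def dihedralAutHom (n : ℕ) : (ZMod n)ˣ →* MulAut (DihedralGroup n) where
  toFun := dihedralAut
  map_one' := by ext x; cases x <;> simp [dihedralAut]
  map_mul' i j := by ext x; cases x <;> simp [dihedralAut, mul_assoc]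

/-- The semidirect product of a dihedral group with a group that acts on it through a character
with values in the units modulo `n`. -/
abbrev TwistedDihedral {n : ℕ} {C : Type} [Group C] (U : C →* (ZMod n)ˣ) : Type :=
  SemidirectProduct (DihedralGroup n) C ((dihedralAutHom n).comp U)

namespace TwistedDihedral

section

variable {n : ℕ} {C : Type} [Group C] {U : C →* (ZMod n)ˣ}

/-- The element `a ^ k * j`. -/
def rot (U : C →* (ZMod n)ˣ) (k : ZMod n) (j : C) : TwistedDihedral U := ⟨.r k, j⟩

/-- The element `b * a ^ k * j`. -/
def refl (U : C →* (ZMod n)ˣ) (k : ZMod n) (j : C) : TwistedDihedral U := ⟨.sr k, j⟩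

theorem eq_rot_or_refl (x : TwistedDihedral U) :
    (∃ k j, x = rot U k j) ∨ ∃ k j, x = refl U k j := by
  obtain ⟨k | k, j⟩ := x
  · exact .inl ⟨k, j, rfl⟩
  · exact .inr ⟨k, j, rfl⟩

@[simp] theorem rot_inj {k l : ZMod n} {i j : C} : rot U k i = rot U l j ↔ k = l ∧ i = j := by
  simp [rot, SemidirectProduct.ext_iff]

@[simp] theorem refl_inj {k l : ZMod n} {i j : C} : refl U k i = refl U l j ↔ k = l ∧ i = j := by
  simp [refl, SemidirectProduct.ext_iff]

@[simp] theorem rot_ne_refl {k l : ZMod n} {i j : C} : rot U k i ≠ refl U l j := by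
  simp [rot, refl, SemidirectProduct.ext_iff]

@[simp] theorem refl_ne_rot {k l : ZMod n} {i j : C} : refl U k i ≠ rot U l j := by
  simp [rot, refl, SemidirectProduct.ext_iff]

theorem one_eq_rot : (1 : TwistedDihedral U) = rot U 0 1 := rfl

@[simp] theorem rot_mul_rot (k l : ZMod n) (i j : C) :
    rot U k i * rot U l j = rot U (k + U i * l) (i * j) := rfl

@[simp] theorem rot_mul_refl (k l : ZMod n) (i j : C) :
    rot U k i * refl U l j = refl U (U i * l - k) (i * j) := rfl

@[simp] theorem refl_mul_rot (k l : ZMod n) (i j : C) :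
    refl U k i * rot U l j = refl U (k + U i * l) (i * j) := rfl

@[simp] theorem refl_mul_refl (k l : ZMod n) (i j : C) :
    refl U k i * refl U l j = rot U (U i * l - k) (i * j) := rfl

@[simp] theorem rot_inv (k : ZMod n) (j : C) :
    (rot U k j)⁻¹ = rot U (-((U j)⁻¹ : (ZMod n)ˣ) * k) j⁻¹ := by
  rw [inv_eq_iff_mul_eq_one, one_eq_rot]
  simp

@[simp] theorem refl_inv (k : ZMod n) (j : C) :
    (refl U k j)⁻¹ = refl U (((U j)⁻¹ : (ZMod n)ˣ) * k) j⁻¹ := by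
  rw [inv_eq_iff_mul_eq_one, one_eq_rot]
  simp

theorem rot_pow (k : ZMod n) (j : C) (m : ℕ) :
    rot U k j ^ m = rot U (k * ∑ t ∈ Finset.range m, (U j : ZMod n) ^ t) (j ^ m) := by
  induction m with
  | zero => simp [one_eq_rot]
  | succ m ih =>
    rw [pow_succ, ih, rot_mul_rot, Finset.sum_range_succ, pow_succ]
    simp
    ring

@[simp] theorem rot_one_pow (k : ZMod n) (m : ℕ) : rot U k 1 ^ m = rot U (m * k) 1 := by
  simp [rot_pow, mul_comm]

/-- The homomorphism with values in a group of order two that detects reflections. -/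
def sign (U : C →* (ZMod n)ˣ) : TwistedDihedral U →* Multiplicative (ZMod 2) where
  toFun x := match x.left with
    | .r _ => .ofAdd 0
    | .sr _ => .ofAdd 1
  map_one' := rfl
  map_mul' x y := by
    obtain ⟨_ | _, _⟩ := x <;> obtain ⟨_ | _, _⟩ := y
    · rfl
    · rfl
    · rfl
    · exact (by decide : Multiplicative.ofAdd (0 : ZMod 2) = .ofAdd 1 * .ofAdd 1)

@[simp] theorem sign_rot (k : ZMod n) (j : C) : sign U (rot U k j) = 1 := rfl

@[simp] theorem sign_refl (k : ZMod n) (j : C) : sign U (refl U k j) = .ofAdd 1 := rfl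

/-- The projection onto the product of the group of order two and the acting group. -/
def proj (U : C →* (ZMod n)ˣ) : TwistedDihedral U →* Multiplicative (ZMod 2) × C :=
  (sign U).prod SemidirectProduct.rightHom

@[simp] theorem proj_rot (k : ZMod n) (j : C) : proj U (rot U k j) = (1, j) := rfl

@[simp] theorem proj_refl (k : ZMod n) (j : C) : proj U (refl U k j) = (.ofAdd 1, j) := rfl

theorem mem_ker_sign {x : TwistedDihedral U} : x ∈ (sign U).ker ↔ ∃ k j, x = rot U k j := by
  obtain ⟨k, j, rfl⟩ | ⟨k, j, rfl⟩ := eq_rot_or_refl x <;> simp [MonoidHom.mem_ker]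

theorem mem_ker_proj {x : TwistedDihedral U} : x ∈ (proj U).ker ↔ ∃ k, x = rot U k 1 := by
  obtain ⟨k, j, rfl⟩ | ⟨k, j, rfl⟩ := eq_rot_or_refl x <;> simp [MonoidHom.mem_ker]

/-- The subgroup of the elements `a ^ k` with `k` in the kernel of a ring homomorphism. -/
def rotKer (U : C →* (ZMod n)ˣ) {R : Type*} [Ring R] (f : ZMod n →+* R) :
    Subgroup (TwistedDihedral U) where
  carrier := {x | ∃ k, f k = 0 ∧ x = rot U k 1}
  one_mem' := ⟨0, map_zero f, rfl⟩
  mul_mem' := by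
    rintro _ _ ⟨k, hk, rfl⟩ ⟨l, hl, rfl⟩
    exact ⟨k + l, by simp [hk, hl], by simp⟩
  inv_mem' := by
    rintro _ ⟨k, hk, rfl⟩
    exact ⟨-k, by simp [hk], by simp⟩

theorem rot_one_mem_rotKer {R : Type*} [Ring R] {f : ZMod n →+* R} {k : ZMod n} :
    rot U k 1 ∈ rotKer U f ↔ f k = 0 :=
  ⟨fun ⟨l, hl, h⟩ => by rwa [(rot_inj.1 h).1], fun h => ⟨k, h, rfl⟩⟩

instance rotKer_normal {R : Type*} [Ring R] (f : ZMod n →+* R) : (rotKer U f).Normal where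
  conj_mem := by
    rintro _ ⟨k, hk, rfl⟩ x
    obtain ⟨l, j, rfl⟩ | ⟨l, j, rfl⟩ := eq_rot_or_refl x
    · exact ⟨U j * k, by simp [hk], by simp⟩
    · exact ⟨-(U j * k), by simp [hk], by simp⟩

/-- The subgroup generated by `b` and the acting group. -/
def complement (U : C →* (ZMod n)ˣ) : Subgroup (TwistedDihedral U) where
  carrier := {x | ∃ j, x = rot U 0 j ∨ x = refl U 0 j}
  one_mem' := ⟨1, .inl rfl⟩
  mul_mem' := by
    rintro _ _ ⟨i, rfl | rfl⟩ ⟨j, rfl | rfl⟩ <;> exact ⟨i * j, by simp⟩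
  inv_mem' := by
    rintro _ ⟨i, rfl | rfl⟩ <;> exact ⟨i⁻¹, by simp⟩

theorem rot_mem_complement {k : ZMod n} {j : C} : rot U k j ∈ complement U ↔ k = 0 :=
  ⟨fun ⟨i, h⟩ => by simp_all, fun h => ⟨j, by simp [h]⟩⟩

theorem refl_mem_complement {k : ZMod n} {j : C} : refl U k j ∈ complement U ↔ k = 0 :=
  ⟨fun ⟨i, h⟩ => by simp_all, fun h => ⟨j, by simp [h]⟩⟩

end

section Comm

variable {n : ℕ} {C : Type} [CommGroup C] {U : C →* (ZMod n)ˣ}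

/-! ### Solvability, the nilpotent residual, and subgroups containing `b` -/

theorem isSolvable (U : C →* (ZMod n)ˣ) : Group.IsSolvable (TwistedDihedral U) := by
  let f : Multiplicative (ZMod n) →* TwistedDihedral U :=
    { toFun k := rot U k.toAdd 1
      map_one' := rfl
      map_mul' k l := by simp }
  refine Group.isSolvable_of_ker_le_range f (proj U) fun x hx => ?_
  obtain ⟨k, rfl⟩ := mem_ker_proj.1 hx
  exact ⟨.ofAdd k, rfl⟩

/-- The quotient by the kernel embeds in an abelian group, so it is nilpotent. -/
theorem nilResidual_le (U : C →* (ZMod n)ˣ) :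
    nilResidual (TwistedDihedral U) ≤ (proj U).ker :=
  sInf_le ⟨inferInstance, Subgroup.isNilpotent_of_ker_le_center (QuotientGroup.kerLift (proj U))
    (by rw [(MonoidHom.ker_eq_bot_iff _).2 (QuotientGroup.kerLift_injective _)]; exact bot_le)⟩

theorem proj_eq_of_mk_nilResidual_eq {x y : TwistedDihedral U}
    (h : (x : TwistedDihedral U ⧸ nilResidual (TwistedDihedral U)) = y) :
    proj U x = proj U y := by
  have := nilResidual_le U (QuotientGroup.eq.1 h)
  rwa [MonoidHom.mem_ker, map_mul, map_inv, inv_mul_eq_one] at this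

/-- If all `1 + U j` are units, then two reflections in the same coset of the rotation subgroup
are conjugate. -/
theorem isConj_refl (hU : ∀ j, IsUnit (1 + (U j : ZMod n))) (k l : ZMod n) (j : C) :
    IsConj (refl U k j) (refl U l j) := by
  obtain ⟨u, hu⟩ := hU j
  rw [isConj_iff]
  -- Conjugation by `a ^ t` replaces `k` by `k - (1 + U j) * t`; solve for `t`.
  refine ⟨rot U ((k - l) * (u⁻¹ : (ZMod n)ˣ)) 1, ?_⟩
  have : (1 + (U j : ZMod n)) * (u⁻¹ : (ZMod n)ˣ) = 1 := by rw [← hu, Units.mul_inv]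
  simp
  linear_combination (l - k) * this

/-- A subgroup that contains the rotations `a ^ k` and the reflection `b` is not a gap group. -/
theorem not_isGapGroup_of_refl_mem [Finite (TwistedDihedral U)]
    (hU : ∀ j, IsUnit (1 + (U j : ZMod n))) (hC : IsPrimePower (Nat.card C))
    {K : Subgroup (TwistedDihedral U)} (hA : (proj U).ker ≤ K) (hb : refl U 0 1 ∈ K) :
    ¬ IsGapGroup K := by
  rintro ⟨V, _, _, _, ρ, h1, h2⟩
  let b : K := ⟨refl U 0 1, hb⟩
  let A := (proj U).ker.subgroupOf K
  let M := (sign U).ker.subgroupOf K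
  let H := (complement U).subgroupOf K
  let P := H ⊓ M
  have hbM : b ∉ M := by simp [M, b, Subgroup.mem_subgroupOf, MonoidHom.mem_ker]
  have hbH : b ∈ H := by simp [H, b, Subgroup.mem_subgroupOf, refl_mem_complement]
  have hM : ∀ h, h ∉ M → h * b⁻¹ ∈ M := by
    rintro ⟨h, hh⟩ hhM
    obtain ⟨k, j, rfl⟩ | ⟨k, j, rfl⟩ := eq_rot_or_refl h
    · exact absurd (Subgroup.mem_subgroupOf.2 (mem_ker_sign.2 ⟨k, j, rfl⟩)) hhM
    · simp [M, b, Subgroup.mem_subgroupOf, MonoidHom.mem_ker]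
  have hA' : ∀ k, rot U k 1 ∈ K := fun k => hA (mem_ker_proj.2 ⟨k, rfl⟩)
  -- Squares are rotations, so `M` is large.
  have hM0 : fixedDim ρ M = 0 := h2 M <| isLarge_of_pow_mem Nat.prime_two fun g => by
    simp only [M, Subgroup.mem_subgroupOf, MonoidHom.mem_ker, Subgroup.coe_pow, map_pow]
    generalize sign U g = z
    revert z
    decide
  have hPH : P ≤ H := inf_le_left
  have hbP : b ∉ P := fun h => hbM h.2
  have hPcard : IsPrimePower (Nat.card P) := by
    obtain ⟨r, k, hr, hrk⟩ := hC
    let f : P →* C := SemidirectProduct.rightHom.comp (K.subtype.comp P.subtype)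
    have hf : Function.Injective f := by
      rw [injective_iff_map_eq_one]
      rintro ⟨⟨x, hx⟩, hxH, hxM⟩ h
      obtain ⟨k, j, rfl⟩ := mem_ker_sign.1 (Subgroup.mem_subgroupOf.1 hxM)
      obtain rfl := rot_mem_complement.1 (Subgroup.mem_subgroupOf.1 hxH)
      obtain rfl : j = 1 := h
      rfl
    have hd := Subgroup.card_dvd_of_injective f hf
    rw [hrk, Nat.dvd_prime_pow hr] at hd
    obtain ⟨i, -, hi⟩ := hd
    exact ⟨r, i, hr, hi⟩
  have hlt : P < H := lt_of_le_of_ne hPH fun h => hbP (h ▸ hbH)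
  -- In coordinates the pair `(a ^ k, j)` goes to `a ^ ((1 + U j) * k) * j`, so bijectivity comes
  -- down to `1 + U j` being a unit.
  let f : A × P → M := fun x => ⟨x.1 * (x.2 * b) * (x.1 : K)⁻¹ * b⁻¹, by
    obtain ⟨⟨⟨x, hx⟩, hxA⟩, ⟨⟨y, hy⟩, hyH, hyM⟩⟩ := x
    obtain ⟨k, rfl⟩ := mem_ker_proj.1 (Subgroup.mem_subgroupOf.1 hxA)
    obtain ⟨l, j, rfl⟩ := mem_ker_sign.1 (Subgroup.mem_subgroupOf.1 hyM)
    simp [M, b, Subgroup.mem_subgroupOf, MonoidHom.mem_ker]⟩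
  have hf : Function.Bijective f := by
    constructor
    · rintro ⟨⟨⟨x, hx⟩, hxA⟩, ⟨⟨y, hy⟩, hyH, hyM⟩⟩ ⟨⟨⟨x', hx'⟩, hxA'⟩, ⟨⟨y', hy'⟩, hyH', hyM'⟩⟩ h
      obtain ⟨k, rfl⟩ := mem_ker_proj.1 (Subgroup.mem_subgroupOf.1 hxA)
      obtain ⟨l, j, rfl⟩ := mem_ker_sign.1 (Subgroup.mem_subgroupOf.1 hyM)
      obtain rfl := rot_mem_complement.1 (Subgroup.mem_subgroupOf.1 hyH)
      obtain ⟨k', rfl⟩ := mem_ker_proj.1 (Subgroup.mem_subgroupOf.1 hxA')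
      obtain ⟨l, j', rfl⟩ := mem_ker_sign.1 (Subgroup.mem_subgroupOf.1 hyM')
      obtain rfl := rot_mem_complement.1 (Subgroup.mem_subgroupOf.1 hyH')
      simp [f, b, Subtype.ext_iff] at h
      obtain ⟨h, rfl⟩ := h
      obtain rfl : k = k' := (hU j).mul_left_cancel (by linear_combination -h)
      rfl
    · rintro ⟨⟨x, hx⟩, hxM⟩
      obtain ⟨k, j, rfl⟩ := mem_ker_sign.1 (Subgroup.mem_subgroupOf.1 hxM)
      obtain ⟨u, hu⟩ := hU j
      have h1 : (1 + (U j : ZMod n)) * (u⁻¹ : (ZMod n)ˣ) = 1 := by rw [← hu, Units.mul_inv]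
      have hj : rot U 0 j ∈ K := by simpa using K.mul_mem (hA' (-k)) hx
      refine ⟨⟨⟨⟨rot U (k * (u⁻¹ : (ZMod n)ˣ)) 1, hA' _⟩, ?_⟩, ⟨⟨rot U 0 j, hj⟩, ?_, ?_⟩⟩, ?_⟩
      · exact Subgroup.mem_subgroupOf.2 (mem_ker_proj.2 ⟨_, rfl⟩)
      · exact Subgroup.mem_subgroupOf.2 (rot_mem_complement.2 rfl)
      · exact Subgroup.mem_subgroupOf.2 (mem_ker_sign.2 ⟨_, _, rfl⟩)
      · simp [f, b, Subtype.ext_iff]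
        linear_combination k * h1
  have key := fixedDim_eq_two_mul ρ (Equiv.ofBijective f hf) (fun x => by simp [f]) hPH hbH hbP
    (fun h hH hP => ⟨H.mul_mem hH (H.inv_mem hbH), hM h fun hm => hP ⟨hH, hm⟩⟩) hbM hM hM0
    (h2 ⊤ isLarge_top)
  have := h1 P H hlt hPcard
  omega

end Comm

/-! ### The case of two odd primes -/

section

variable {p q : ℕ}

/-- The reduction modulo `p` of integers modulo `p * q`. -/
abbrev castLeft (p q : ℕ) : ZMod (p * q) →+* ZMod p := ZMod.castHom (dvd_mul_right p q) _

/-- The reduction modulo `q` of integers modulo `p * q`. -/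
abbrev castRight (p q : ℕ) : ZMod (p * q) →+* ZMod q := ZMod.castHom (dvd_mul_left q p) _

theorem eq_zero_of_castLeft_of_castRight (hpq : p.Coprime q) {x : ZMod (p * q)}
    (h1 : castLeft p q x = 0) (h2 : castRight p q x = 0) : x = 0 := by
  obtain ⟨m, rfl⟩ := ZMod.intCast_surjective x
  rw [map_intCast, ZMod.intCast_zmod_eq_zero_iff_dvd] at h1 h2
  rw [ZMod.intCast_zmod_eq_zero_iff_dvd]
  push_cast
  exact IsCoprime.mul_dvd (Nat.isCoprime_iff_coprime.2 hpq) h1 h2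

theorem isUnit_of_castLeft_of_castRight (hp : p.Prime) (hq : q.Prime) {x : ZMod (p * q)}
    (h1 : castLeft p q x ≠ 0) (h2 : castRight p q x ≠ 0) : IsUnit x := by
  have : NeZero (p * q) := ⟨(Nat.mul_pos hp.pos hq.pos).ne'⟩
  obtain ⟨m, rfl⟩ := ZMod.natCast_zmod_surjective x
  rw [map_natCast, Ne, ZMod.natCast_eq_zero_iff] at h1 h2
  rw [ZMod.isUnit_iff_coprime]
  exact (((hp.coprime_iff_not_dvd.2 h1).mul_left (hq.coprime_iff_not_dvd.2 h2))).symm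

theorem isUnit_two (hp : Odd p) (hq : Odd q) : IsUnit (2 : ZMod (p * q)) := by
  have := (ZMod.isUnit_iff_coprime 2 (p * q)).2 (Nat.coprime_two_left.2 (hp.mul hq))
  exact_mod_cast this

/-- A character `U` of the cyclic group of order `q` with values in the units modulo `p * q` that
is trivial modulo `q` and faithful modulo `p`, where `p` and `q` are distinct odd primes. -/
structure IsFrobeniusTwist (U : Multiplicative (ZMod q) →* (ZMod (p * q))ˣ) : Prop where
  prime_left : p.Prime
  prime_right : q.Prime
  odd_left : Odd p
  odd_right : Odd q
  ne : p ≠ q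
  castRight_eq : ∀ j, castRight p q (U j) = 1
  castLeft_ne : ∀ j, j ≠ 1 → castLeft p q (U j) ≠ 1

variable {U : Multiplicative (ZMod q) →* (ZMod (p * q))ˣ}

theorem pow_card_eq_one (j : Multiplicative (ZMod q)) : j ^ q = 1 := by
  rw [← ofAdd_toAdd j, ← ofAdd_nsmul]
  simp

namespace IsFrobeniusTwist

theorem coprime (hU : IsFrobeniusTwist U) : p.Coprime q :=
  (Nat.coprime_primes hU.prime_left hU.prime_right).2 hU.ne

theorem val_pow (j : Multiplicative (ZMod q)) : (U j : ZMod (p * q)) ^ q = 1 := by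
  rw [← Units.val_pow_eq_pow_val, ← map_pow, pow_card_eq_one, map_one, Units.val_one]

/-- For odd `q`, `1 + u` divides `1 + u ^ q = 2`. -/
theorem isUnit_one_add (hU : IsFrobeniusTwist U) (j : Multiplicative (ZMod q)) :
    IsUnit (1 + (U j : ZMod (p * q))) := by
  refine isUnit_of_dvd_unit ?_ (isUnit_two hU.odd_left hU.odd_right)
  have := hU.odd_right.add_dvd_pow_add_pow (1 : ZMod (p * q)) (U j)
  rwa [one_pow, val_pow, one_add_one_eq_two] at this

/-- Modulo `p`, the product of the sum with `u - 1 ≠ 0` is `u ^ q - 1 = 0`; modulo `q`, the sum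
consists of `q` ones. -/
theorem geom_sum_eq_zero (hU : IsFrobeniusTwist U) {j : Multiplicative (ZMod q)} (hj : j ≠ 1) :
    ∑ t ∈ Finset.range q, (U j : ZMod (p * q)) ^ t = 0 := by
  have := Fact.mk hU.prime_left
  apply eq_zero_of_castLeft_of_castRight hU.coprime
  · have h := congrArg (castLeft p q) (geom_sum_mul (U j : ZMod (p * q)) q)
    rw [val_pow, sub_self, map_zero, map_mul, map_sub, map_one] at h
    exact (mul_eq_zero.1 h).resolve_right (sub_ne_zero.2 (hU.castLeft_ne j hj))
  · simp only [map_sum, map_pow, hU.castRight_eq]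
    simp

theorem finite (hU : IsFrobeniusTwist U) : Finite (TwistedDihedral U) := by
  have : NeZero (p * q) := ⟨(Nat.mul_pos hU.prime_left.pos hU.prime_right.pos).ne'⟩
  have : NeZero q := ⟨hU.prime_right.ne_zero⟩
  have : Finite (Multiplicative (ZMod q)) := inferInstanceAs (Finite (ZMod q))
  exact Finite.of_equiv _ SemidirectProduct.equivProd.symm

theorem even_card (U : Multiplicative (ZMod q) →* (ZMod (p * q))ˣ) :
    Even (Nat.card (TwistedDihedral U)) := by
  rw [SemidirectProduct.card, DihedralGroup.nat_card, mul_assoc]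
  exact even_two_mul _

/-- This confines rotations of composite order to `⟨a⟩`. -/
theorem rot_pow_right (hU : IsFrobeniusTwist U) (k : ZMod (p * q)) {j : Multiplicative (ZMod q)}
    (hj : j ≠ 1) : rot U k j ^ q = 1 := by
  rw [rot_pow, hU.geom_sum_eq_zero hj, mul_zero, pow_card_eq_one, one_eq_rot]

theorem not_isComposite_of_dvd_prime {r m : ℕ} (hr : r.Prime) (h : m ∣ r) : ¬ IsComposite m := by
  rintro ⟨s, t, hs, ht, hst, hsm, htm⟩
  exact hst (((Nat.prime_dvd_prime_iff_eq hs hr).1 (hsm.trans h)).trans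
    ((Nat.prime_dvd_prime_iff_eq ht hr).1 (htm.trans h)).symm)

/-- A rotation of composite order generates the subgroup of the elements `a ^ k`. -/
theorem ker_proj_le_zpowers (hU : IsFrobeniusTwist U) {k : ZMod (p * q)}
    {j : Multiplicative (ZMod q)} (h : IsComposite (orderOf (rot U k j))) :
    (proj U).ker ≤ Subgroup.zpowers (rot U k j) := by
  have hj : j = 1 := by
    by_contra hj
    exact not_isComposite_of_dvd_prime hU.prime_right
      (orderOf_dvd_of_pow_eq_one (hU.rot_pow_right k hj)) h
  subst hj
  -- If `k` vanished modulo one of the primes, the order of `a ^ k` would divide the other.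
  have hk : IsUnit k := by
    apply isUnit_of_castLeft_of_castRight hU.prime_left hU.prime_right
    · refine fun h0 => not_isComposite_of_dvd_prime hU.prime_right (orderOf_dvd_of_pow_eq_one ?_) h
      rw [rot_one_pow, one_eq_rot, rot_inj]
      exact ⟨eq_zero_of_castLeft_of_castRight hU.coprime (by rw [map_mul, h0, mul_zero])
        (by simp), rfl⟩
    · refine fun h0 => not_isComposite_of_dvd_prime hU.prime_left (orderOf_dvd_of_pow_eq_one ?_) h
      rw [rot_one_pow, one_eq_rot, rot_inj]
      exact ⟨eq_zero_of_castLeft_of_castRight hU.coprime (by simp)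
        (by rw [map_mul, h0, mul_zero]), rfl⟩
  intro x hx
  obtain ⟨l, rfl⟩ := mem_ker_proj.1 hx
  obtain ⟨u, rfl⟩ := hk
  have : NeZero (p * q) := ⟨(Nat.mul_pos hU.prime_left.pos hU.prime_right.pos).ne'⟩
  obtain ⟨m, hm⟩ := ZMod.natCast_zmod_surjective (l * ((u⁻¹ : (ZMod (p * q))ˣ) : ZMod (p * q)))
  have := Subgroup.npow_mem_zpowers (rot U (u : ZMod (p * q)) 1) m
  rwa [rot_one_pow, hm, Units.inv_mul_cancel_right] at this

/-! #### Gap subgroups -/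

/-- A group of rotations that contains all `a ^ k` is not a gap group. -/
theorem not_isGapGroup_of_le_ker_sign (hU : IsFrobeniusTwist U)
    {K : Subgroup (TwistedDihedral U)} (hA : (proj U).ker ≤ K) (hK : K ≤ (sign U).ker) :
    ¬ IsGapGroup K := by
  have := hU.finite
  have := Fact.mk hU.prime_right
  have := Fact.mk hU.prime_left
  -- This is the subgroup of order `p`. It contains all `q`-th powers of rotations: they are trivial
  -- for `j ≠ 1` and equal to `a ^ (q * k)` for `j = 1`.
  have hL : IsLarge ((rotKer U (castRight p q)).subgroupOf K) := by
    refine isLarge_of_pow_mem hU.prime_right ?_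
    rintro ⟨x, hx⟩
    obtain ⟨k, j, rfl⟩ := mem_ker_sign.1 (hK hx)
    rw [Subgroup.mem_subgroupOf, Subgroup.coe_pow]
    by_cases hj : j = 1
    · subst hj
      rw [rot_one_pow, rot_one_mem_rotKer]
      simp
    · change rot U k j ^ q ∈ _
      rw [hU.rot_pow_right k hj]
      exact one_mem _
  refine not_isGapGroup_of_isLarge hL (lt_of_le_of_ne le_top fun h => ?_) ?_
  · have h1 : (⟨rot U 1 1, hA (mem_ker_proj.2 ⟨1, rfl⟩)⟩ : K) ∈
        (rotKer U (castRight p q)).subgroupOf K := h ▸ Subgroup.mem_top _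
    rw [Subgroup.mem_subgroupOf, rot_one_mem_rotKer, map_one] at h1
    exact one_ne_zero h1
  · have : IsPGroup p ((rotKer U (castRight p q)).subgroupOf K) := by
      rw [isPGroup_iff_pow_pow_eq_one]
      rintro ⟨⟨x, hxK⟩, hx⟩
      obtain ⟨k, hk, rfl⟩ := Subgroup.mem_subgroupOf.1 hx
      refine ⟨1, Subtype.ext (Subtype.ext ?_)⟩
      change rot U k 1 ^ p ^ 1 = 1
      rw [pow_one, rot_one_pow, one_eq_rot, rot_inj]
      exact ⟨eq_zero_of_castLeft_of_castRight hU.coprime (by simp)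
        (by rw [map_mul, hk, mul_zero]), rfl⟩
    obtain ⟨n, hn⟩ := this.exists_card_eq
    exact ⟨p, n, hU.prime_left, hn⟩

theorem not_isGapGroup (hU : IsFrobeniusTwist U) {K : Subgroup (TwistedDihedral U)}
    (hA : (proj U).ker ≤ K) : ¬ IsGapGroup K := by
  by_cases hK : K ≤ (sign U).ker
  · exact hU.not_isGapGroup_of_le_ker_sign hA hK
  obtain ⟨x, hx, hxs⟩ := SetLike.not_le_iff_exists.1 hK
  obtain ⟨k, j, rfl⟩ | ⟨k, j, rfl⟩ := eq_rot_or_refl x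
  · exact absurd (mem_ker_sign.2 ⟨k, j, rfl⟩) hxs
  have := hU.finite
  refine not_isGapGroup_of_refl_mem hU.isUnit_one_add
    ⟨q, 1, hU.prime_right, by rw [pow_one]; exact Nat.card_zmod q⟩ hA ?_
  have h1 : refl U k j ^ q ∈ K := K.pow_mem hx q
  -- As `q` is odd, the `q`-th power stays a reflection while its component in the acting group
  -- dies; hence it differs from `b` by an element of `⟨a⟩`.
  have h2 : proj U (refl U k j ^ q) = (.ofAdd 1, 1) := by
    rw [map_pow, proj_refl, Prod.pow_mk, pow_card_eq_one]
    obtain ⟨m, hm⟩ := hU.odd_right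
    have : (Multiplicative.ofAdd (1 : ZMod 2)) ^ 2 = 1 := by decide
    rw [hm, pow_add, pow_mul, this, one_pow, one_mul, pow_one]
  have h3 : proj U (refl U 0 1 * (refl U k j ^ q)⁻¹) = 1 := by
    rw [map_mul, map_inv, h2, proj_refl, mul_inv_cancel]
  have := K.mul_mem (hA (MonoidHom.mem_ker.2 h3)) h1
  rwa [inv_mul_cancel_right] at this

/-! #### The Sumi condition -/

/-- Both components of an involution would be killed by 2, which is invertible modulo `p * q` and
prime to `q`. -/
theorem not_haveConjInvolutions (hU : IsFrobeniusTwist U) {k : ZMod (p * q)}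
    {j : Multiplicative (ZMod q)} {y : TwistedDihedral U} :
    ¬ HaveConjInvolutions (rot U k j) y := by
  rintro ⟨-, -, s, hs, -, -, hs2, -⟩
  have hs' : s ∈ (sign U).ker :=
    (Subgroup.zpowers_le.2 (mem_ker_sign.2 ⟨k, j, rfl⟩)) hs
  obtain ⟨l, i, rfl⟩ := mem_ker_sign.1 hs'
  have h1 := pow_orderOf_eq_one (rot U l i)
  rw [hs2] at h1
  have hi2 : i ^ 2 = 1 := by
    rw [rot_pow, one_eq_rot, rot_inj] at h1
    exact h1.2
  have hi : i = 1 := by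
    have := hU.odd_right.coprime_two_left
    rw [← orderOf_eq_one_iff]
    exact Nat.eq_one_of_dvd_coprimes this (orderOf_dvd_of_pow_eq_one hi2)
      (orderOf_dvd_of_pow_eq_one (pow_card_eq_one i))
  subst hi
  rw [rot_one_pow, one_eq_rot, rot_inj] at h1
  have hl : l = 0 := (isUnit_two hU.odd_left hU.odd_right).mul_left_cancel (by simpa using h1.1)
  rw [hl, ← one_eq_rot, orderOf_one] at hs2
  omega

theorem not_sumiNilCondition (hU : IsFrobeniusTwist U) :
    ¬ SumiNilCondition (TwistedDihedral U) := by
  rintro ⟨x, y, hx, -, hxy, hmk, h⟩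
  have hproj := proj_eq_of_mk_nilResidual_eq hmk
  obtain ⟨k, j, rfl⟩ | ⟨k, j, rfl⟩ := eq_rot_or_refl x
  · obtain h | ⟨K, hK, hxK, -⟩ := h
    · exact hU.not_haveConjInvolutions h
    · exact hU.not_isGapGroup
        ((hU.ker_proj_le_zpowers hx).trans (Subgroup.zpowers_le.2 hxK)) hK
  · obtain ⟨l, i, rfl⟩ | ⟨l, i, rfl⟩ := eq_rot_or_refl y
    · simp at hproj
    · obtain rfl : j = i := by simpa using hproj
      exact hxy (.inl (isConj_refl hU.isUnit_one_add k l j))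

/-! #### Quotients -/

theorem rot_one_mem_of_two (hU : IsFrobeniusTwist U) {N : Subgroup (TwistedDihedral U)}
    (h : rot U 2 1 ∈ N) (k : ZMod (p * q)) : rot U k 1 ∈ N := by
  have : NeZero (p * q) := ⟨(Nat.mul_pos hU.prime_left.pos hU.prime_right.pos).ne'⟩
  obtain ⟨u, hu⟩ := isUnit_two hU.odd_left hU.odd_right
  obtain ⟨m, hm⟩ := ZMod.natCast_zmod_surjective (k * ((u⁻¹ : (ZMod (p * q))ˣ) : ZMod (p * q)))
  have := N.pow_mem h m
  rwa [rot_one_pow, hm, ← hu, Units.inv_mul_cancel_right] at this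

theorem refl_pow_two : refl U 0 1 ^ 2 = 1 := by
  simp [pow_two, one_eq_rot]

/-- The commutator of `a` and `b` is `a ^ 2`, which generates `⟨a⟩`. -/
theorem rot_one_mem_of_refl_mem (hU : IsFrobeniusTwist U) {N : Subgroup (TwistedDihedral U)}
    [hN : N.Normal] (hb : refl U 0 1 ∈ N) (k : ZMod (p * q)) : rot U k 1 ∈ N := by
  refine hU.rot_one_mem_of_two ?_ k
  have := N.mul_mem (hN.conj_mem _ hb (rot U 1 1)) hb
  have e : rot U 1 1 * refl U 0 1 * (rot U 1 1)⁻¹ * refl U 0 1 = rot U 2 1 := by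
    simp
    norm_num
  rwa [e] at this

/-- A quotient of odd order kills the involution `b`, hence `⟨a⟩` as well. It is then covered by the
acting group, so its generator has order dividing `q`. -/
theorem not_isComposite_card_quotient (hU : IsFrobeniusTwist U)
    (N : Subgroup (TwistedDihedral U)) [N.Normal] [IsCyclic (TwistedDihedral U ⧸ N)]
    (hodd : Odd (Nat.card (TwistedDihedral U ⧸ N))) :
    ¬ IsComposite (Nat.card (TwistedDihedral U ⧸ N)) := by
  have := hU.finite
  have hb : refl U 0 1 ∈ N :=
    mem_of_pow_eq_one_of_coprime refl_pow_two hodd.coprime_two_left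
  obtain ⟨g, hg⟩ := IsCyclic.exists_generator (α := TwistedDihedral U ⧸ N)
  refine not_isComposite_of_dvd_prime hU.prime_right ?_
  rw [← orderOf_eq_card_of_forall_mem_zpowers hg]
  apply orderOf_dvd_of_pow_eq_one
  obtain ⟨x, rfl⟩ := QuotientGroup.mk_surjective g
  have key : ∃ j, (x : TwistedDihedral U ⧸ N) = (rot U 0 j : TwistedDihedral U) := by
    obtain ⟨k, j, rfl⟩ | ⟨k, j, rfl⟩ := eq_rot_or_refl x
    · refine ⟨j, (QuotientGroup.eq.2 ?_).symm⟩
      simpa using hU.rot_one_mem_of_refl_mem hb _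
    · refine ⟨j, (QuotientGroup.eq.2 ?_).symm⟩
      have := N.mul_mem hb (hU.rot_one_mem_of_refl_mem hb (((U j)⁻¹ : (ZMod (p * q))ˣ) * k))
      simpa using this
  obtain ⟨j, hj⟩ := key
  rw [hj, ← QuotientGroup.mk_pow, rot_pow, pow_card_eq_one, zero_mul, ← one_eq_rot,
    QuotientGroup.mk_one]

/-! ### The Oliver property -/

theorem isOliverGroup (hU : IsFrobeniusTwist U) : IsOliverGroup (TwistedDihedral U) := by
  rintro ⟨H, P, hH, hP, ⟨r, n, hr, hrn⟩, ⟨s, m, hs, hsm⟩, hcyc⟩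
  have := hU.finite
  have := Fact.mk hU.prime_left
  have := Fact.mk hU.prime_right
  have hPpow : ∀ z ∈ P, z ^ r ^ n = 1 := fun z hz =>
    orderOf_dvd_iff_pow_eq_one.1 (hrn ▸ Subgroup.orderOf_dvd_natCard P hz)
  have hcomm : ∀ (x y : TwistedDihedral U) (hx : x ∈ H) (hy : y ∈ H),
      (x * y * x⁻¹ * y⁻¹) ^ r ^ n = 1 := by
    intro x y hx hy
    have h := commutator_mem_of_isCyclic (N := P) ⟨x, hx⟩ ⟨y, hy⟩
    exact congrArg (fun z : H => (z : TwistedDihedral U)) (hPpow _ h)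
  by_cases hs2 : s = 2
  · subst hs2
    -- A quotient whose order is a power of two kills elements of odd order, so `H` contains all
    -- rotations.
    have hc : ∀ j, rot U 0 j ∈ H := fun j => by
      refine mem_of_pow_eq_one_of_coprime (m := q) ?_ ?_
      · rw [rot_pow, zero_mul, pow_card_eq_one, one_eq_rot]
      · rw [hsm]
        exact (hU.odd_right.coprime_two_left).symm.pow_right m
    have ha : ∀ k, rot U k 1 ∈ H := fun k => by
      refine mem_of_pow_eq_one_of_coprime (m := p * q) ?_ ?_
      · rw [rot_one_pow, CharP.cast_eq_zero, zero_mul, one_eq_rot]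
      · rw [hsm]
        exact ((hU.odd_left.mul hU.odd_right).coprime_two_left).symm.pow_right m
    let c : Multiplicative (ZMod q) := .ofAdd 1
    have hc1 : c ≠ 1 := fun h => one_ne_zero (α := ZMod q) h
    -- The commutator of `a` and `c` is `a ^ (1 - U c)`, whose exponent is nonzero modulo `p`; being
    -- killed by `r ^ n`, it forces `p ∣ r ^ n`.
    have hrp : r = p := by
      have h := hcomm _ _ (ha 1) (hc c)
      simp only [rot_inv, rot_mul_rot, rot_one_pow, one_mul, mul_one, map_one, Units.val_one,
        mul_zero, add_zero, inv_one, mul_inv_cancel, one_eq_rot, rot_inj] at h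
      have h := congrArg (castLeft p q) h.1
      rw [map_mul, map_natCast, map_zero] at h
      rcases mul_eq_zero.1 h with h | h
      · rw [ZMod.natCast_eq_zero_iff] at h
        exact ((Nat.prime_dvd_prime_iff_eq hU.prime_left hr).1
          (hU.prime_left.dvd_of_dvd_pow h)).symm
      · exfalso
        apply hU.castLeft_ne c hc1
        rw [map_add, map_mul, map_neg, map_one, mul_neg_one, add_neg_eq_zero] at h
        exact h.symm
    subst hrp
    let x : H := ⟨rot U r 1, ha _⟩
    let y : H := ⟨rot U 0 c, hc c⟩
    have hx : (x : H ⧸ P) ^ q = 1 := by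
      rw [← QuotientGroup.mk_pow, show x ^ q = 1 from Subtype.ext ?_, QuotientGroup.mk_one]
      change rot U r 1 ^ q = 1
      rw [rot_one_pow, ← Nat.cast_mul, mul_comm q, CharP.cast_eq_zero, one_eq_rot]
    have hy : (y : H ⧸ P) ^ q = 1 := by
      rw [← QuotientGroup.mk_pow, show y ^ q = 1 from Subtype.ext ?_, QuotientGroup.mk_one]
      change rot U 0 c ^ q = 1
      rw [rot_pow, zero_mul, pow_card_eq_one, one_eq_rot]
    have hpow : ∀ z ∈ P, (z : TwistedDihedral U) ^ r ^ n = 1 := fun z hz =>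
      congrArg (fun z : H => (z : TwistedDihedral U)) (hPpow z hz)
    have hrq : ((r ^ n : ℕ) : ZMod q) ≠ 0 := by
      rw [Ne, ZMod.natCast_eq_zero_iff]
      exact fun h => hU.ne ((Nat.prime_dvd_prime_iff_eq hU.prime_right hr).1
        (hU.prime_right.dvd_of_dvd_pow h)).symm
    have hy1 : (y : H ⧸ P) ≠ 1 := by
      rw [Ne, QuotientGroup.eq_one_iff]
      intro h
      have h := hpow _ h
      change rot U 0 c ^ _ = 1 at h
      rw [rot_pow, one_eq_rot, rot_inj, ← ofAdd_nsmul] at h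
      apply hrq
      simpa using h.2
    -- Since `H ⧸ P` is cyclic, `a ^ p` agrees modulo `P` with a power of `c`, and their quotient
    -- has order a power of `p`.
    obtain ⟨i, hi⟩ := Subgroup.mem_zpowers_iff.1
      (mem_zpowers_of_pow_prime_eq_one hU.prime_right hx hy hy1)
    rw [← QuotientGroup.mk_zpow, QuotientGroup.eq] at hi
    have h := hpow _ hi
    obtain ⟨j, hj⟩ : ∃ j, (y : TwistedDihedral U) ^ i = rot U 0 j := by
      have h1 : (y : TwistedDihedral U) ^ i ∈ (sign U).ker := zpow_mem (mem_ker_sign.2 ⟨0, c, rfl⟩) i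
      have h2 : (y : TwistedDihedral U) ^ i ∈ complement U := zpow_mem (rot_mem_complement.2 rfl) i
      obtain ⟨k, j, hj⟩ := mem_ker_sign.1 h1
      rw [hj, rot_mem_complement] at h2
      exact ⟨j, by rw [hj, h2]⟩
    rw [Subgroup.coe_mul, Subgroup.coe_inv, Subgroup.coe_zpow, hj] at h
    change ((rot U 0 j)⁻¹ * rot U r 1) ^ _ = 1 at h
    simp only [rot_inv, rot_mul_rot, mul_zero, zero_add, rot_pow, one_eq_rot, rot_inj] at h
    -- Modulo `q` the twist disappears, and the exponent of `a` in the power becomes `r * r ^ n`,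
    -- which is not zero modulo `q`.
    have h := congrArg (castRight r q) h.1
    rw [mul_one, map_mul, map_mul, map_sum, hU.castRight_eq, one_mul, map_natCast, map_zero] at h
    simp only [map_pow, hU.castRight_eq, one_pow, Finset.sum_const, Finset.card_range,
      nsmul_eq_mul, mul_one] at h
    rcases mul_eq_zero.1 h with h | h
    · rw [ZMod.natCast_eq_zero_iff, Nat.prime_dvd_prime_iff_eq hU.prime_right hr] at h
      exact hU.ne h.symm
    · exact hrq h
  · have hb : refl U 0 1 ∈ H := by
      refine mem_of_pow_eq_one_of_coprime refl_pow_two ?_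
      rw [hsm]
      exact ((Nat.coprime_primes Nat.prime_two hs).2 (Ne.symm hs2)).pow_right m
    have ha := hU.rot_one_mem_of_refl_mem hb
    have h := hcomm _ _ (ha 1) hb
    have e : rot U 1 1 * refl U 0 1 * (rot U 1 1)⁻¹ * (refl U 0 1)⁻¹ = rot U 2 1 := by
      simp
      norm_num
    rw [e, rot_one_pow, one_eq_rot, rot_inj] at h
    have h0 : ((r ^ n : ℕ) : ZMod (p * q)) = 0 :=
      (isUnit_two hU.odd_left hU.odd_right).mul_right_cancel (h.1.trans (zero_mul _).symm)
    rw [ZMod.natCast_eq_zero_iff] at h0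
    apply hU.ne
    rw [(Nat.prime_dvd_prime_iff_eq hU.prime_left hr).1
        (hU.prime_left.dvd_of_dvd_pow ((dvd_mul_right p q).trans h0)),
      (Nat.prime_dvd_prime_iff_eq hU.prime_right hr).1
        (hU.prime_right.dvd_of_dvd_pow ((dvd_mul_left q p).trans h0))]

theorem isSpecialOliver (hU : IsFrobeniusTwist U) : IsSpecialOliver (TwistedDihedral U) where
  finite := hU.finite
  solvable := isSolvable U
  oliver := hU.isOliverGroup
  even_card := even_card U
  cyclic_quotient N _ _ h := hU.not_isComposite_card_quotient N h.1 h.2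
  not_sumi := hU.not_sumiNilCondition

end IsFrobeniusTwist

/-! ### Identification of `G_{p,q}` as a twisted dihedral group -/

theorem cyclicHom_dihedralAut {n m : ℕ} [NeZero m] {i : (ZMod n)ˣ} (h : dihedralAut i ^ m = 1)
    (hi : i ^ m = 1) :
    cyclicHom m (dihedralAut i) h = (dihedralAutHom n).comp (cyclicHom m i hi) := by
  refine MonoidHom.ext fun j => ?_
  obtain ⟨k, hk⟩ := ZMod.natCast_zmod_surjective j.toAdd
  have : j = Multiplicative.ofAdd 1 ^ k := by
    rw [← ofAdd_nsmul, nsmul_one, hk, ofAdd_toAdd]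
  rw [this, map_pow, map_pow, cyclicHom_generator, MonoidHom.comp_apply, cyclicHom_generator]
  rfl

/-- Both congruence conditions reduce to the generator. For faithfulness modulo `p`, the order of
`i` there divides the prime `q`, so `i ^ k = 1` with `q ∤ k` would give `i = 1`. -/
theorem isFrobeniusTwist_cyclicHom (hp : p.Prime) (hq : q.Prime) (hp2 : Odd p) (hq2 : Odd q)
    (hne : p ≠ q) {i : (ZMod (p * q))ˣ} (hi : i ^ q = 1) (h1 : castRight p q i = 1)
    (h2 : castLeft p q i ≠ 1) : IsFrobeniusTwist (cyclicHom q i hi) where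
  prime_left := hp
  prime_right := hq
  odd_left := hp2
  odd_right := hq2
  ne := hne
  castRight_eq j := by
    have : NeZero q := ⟨hq.ne_zero⟩
    obtain ⟨k, hk⟩ := ZMod.natCast_zmod_surjective j.toAdd
    have : j = Multiplicative.ofAdd 1 ^ k := by
      rw [← ofAdd_nsmul, nsmul_one, hk, ofAdd_toAdd]
    rw [this, map_pow, cyclicHom_generator, Units.val_pow_eq_pow_val, map_pow, h1, one_pow]
  castLeft_ne j hj h := by
    have : Fact q.Prime := ⟨hq⟩
    obtain ⟨k, hk⟩ := ZMod.natCast_zmod_surjective j.toAdd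
    have hjk : j = Multiplicative.ofAdd 1 ^ k := by
      rw [← ofAdd_nsmul, nsmul_one, hk, ofAdd_toAdd]
    rw [hjk, map_pow, cyclicHom_generator, Units.val_pow_eq_pow_val, map_pow] at h
    have hq1 : castLeft p q i ^ q = 1 := by
      rw [← map_pow, ← Units.val_pow_eq_pow_val, hi, Units.val_one, map_one]
    apply h2
    rw [← orderOf_eq_one_iff]
    refine Nat.eq_one_of_dvd_coprimes ((hq.coprime_iff_not_dvd (n := k)).2 fun hd => hj ?_)
      (orderOf_dvd_of_pow_eq_one hq1) (orderOf_dvd_of_pow_eq_one h)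
    rw [hjk, ← ofAdd_nsmul, nsmul_one, (ZMod.natCast_eq_zero_iff k q).2 hd, ofAdd_zero]

end

end TwistedDihedral

end SpecialOliver

open SpecialOliver TwistedDihedral in
theorem mainTheorem2 (p q : ℕ) (v : ℤ) (hp : p.Prime) (hq : q.Prime) (hp_odd : Odd p)
    (hq_odd : Odd q) (hqp : q ∣ p - 1) (hv : IsPrimitiveRoot (v : ZMod p) (p - 1))
    (hqv : ¬ (q : ℤ) ∣ v) :
    SpecialOliver.IsSpecialOliver (SpecialOliver.Gpq hp hq hqp hv hqv) := by
  have : Fact q.Prime := ⟨hq⟩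
  have hp1 : 0 < p - 1 := Nat.sub_pos_of_lt hp.one_lt
  have hne : p ≠ q := fun h => by
    have := Nat.le_of_dvd hp1 hqp
    omega
  have hval : ((twist hp hq hqp hv hqv : (ZMod (p * q))ˣ) : ZMod (p * q)) =
      (v : ZMod (p * q)) ^ ((p - 1) * (q - 1) / q) := rfl
  have hi : twist hp hq hqp hv hqv ^ q = 1 := by rw [twist, Units.pow_ofPowEqOne]
  -- The exponent is `(p - 1) / q * (q - 1)`, a multiple of `q - 1`, so Fermat's little theorem
  -- applies modulo `q`.
  have h1 : castRight p q (twist hp hq hqp hv hqv) = 1 := by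
    have h0 : (v : ZMod q) ≠ 0 := fun h => hqv ((ZMod.intCast_zmod_eq_zero_iff_dvd _ _).1 h)
    rw [hval, map_pow, map_intCast, ← Nat.div_mul_right_comm hqp, mul_comm, pow_mul,
      ZMod.pow_card_sub_one_eq_one h0, one_pow]
  -- With `p - 1 = q * m` the exponent is `m * (q - 1)`; divisibility by the order `q * m` of `v`
  -- would give `q ∣ q - 1`.
  have h2 : castLeft p q (twist hp hq hqp hv hqv) ≠ 1 := by
    rw [hval, map_pow, map_intCast, Ne, hv.pow_eq_one_iff_dvd, ← Nat.div_mul_right_comm hqp]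
    obtain ⟨m, hm⟩ := hqp
    intro h
    rw [hm, Nat.mul_div_cancel_left _ hq.pos, mul_comm q m] at h
    have hm0 : 0 < m := Nat.pos_of_ne_zero fun h0 => by simp [h0] at hm; omega
    have := Nat.le_of_dvd (Nat.sub_pos_of_lt hq.one_lt) (Nat.dvd_of_mul_dvd_mul_left hm0 h)
    have := hq.pos
    omega
  unfold Gpq
  rw [cyclicHom_dihedralAut _ hi]
  exact (isFrobeniusTwist_cyclicHom hp hq hp_odd hq_odd hne hi h1 h2).isSpecialOliver
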